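/- Let $0\le r<n$ be integers and let $V$, $W$ be complex vector spaces of dimension $n$. Let $X$ be a smooth projective complex variety and $Z\subset X$ a closed subscheme with an isomorphism $Z\cong Gr(r,V)$, the Grassmannian of $r$-dimensional subspaces of $V$, under which the normal bundle is $N_{Z/X}\cong S\otimes W^\vee$, where $S\to Gr(r,V)$ is the universal subbundle. Then $$\dim Z=r(n-r),\qquad \dim X=r(n-r)+rn .$$ Moreover, let $\bar\phi:X\to\bar X$ be a proper morphism of complex varieties which contracts $Z$ to a point $p$, that is, $\bar\phi^{-1}(p)=Z$ as sets and $\bar\phi$ is an isomorphism over $\bar X\setminus\{p\}$. Then $\bar\phi$ is semismall: it is proper and surjective and, for every integer $k\ge 0$, $$\dim\{y\in\bar X:\ \dim\bar\phi^{-1}(y)\ge k\}+2k\le\dim X ,$$ where the empty set has dimension $-\infty$. -/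

import Mathlib

open CategoryTheory AlgebraicGeometry TensorProduct

noncomputable section

namespace GrassmannianFlop

/-- Schemes over the complex numbers. -/
abbrev SchC := Over (Spec (CommRingCat.of ℂ))

/-- A complex variety: an integral separated scheme of finite type over `ℂ`. -/
structure IsVariety (X : SchC) : Prop where
  integral : IsIntegral X.left
  separated : IsSeparated X.hom
  finiteType : LocallyOfFiniteType X.hom
  quasiCompact : QuasiCompact X.hom

/-- The homogeneous coordinate ring `ℂ[x₀, …, x_N]` with its grading by degree. -/
abbrev coordGrading (N : ℕ) : ℕ → Submodule ℂ (MvPolynomial (Fin (N + 1)) ℂ) :=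
  MvPolynomial.homogeneousSubmodule (Fin (N + 1)) ℂ

/-- Projective space `ℙ^N` over `ℂ`. -/
def projectiveSpace (N : ℕ) : SchC :=
  letI : GradedAlgebra (coordGrading N) := MvPolynomial.gradedAlgebra
  Over.mk (Proj.toSpecZero (coordGrading N) ≫
    Spec.map (CommRingCat.ofHom (algebraMap ℂ (coordGrading N 0))))

/-- A smooth projective complex variety: smooth and integral, with a closed embedding in some
`ℙ^N`. -/
structure IsSmoothProjectiveVariety (X : SchC) : Prop where
  integral : IsIntegral X.left
  smooth : Smooth X.hom
  projective : ∃ (N : ℕ) (j : X ⟶ projectiveSpace N), IsClosedImmersion j.left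

/-! ### The Grassmannian and its tautological bundle -/

/-- The functor of points of `Gr(r, V)`: it sends a `ℂ`-algebra `A` to the set of rank `r`
subbundles of the trivial bundle `A ⊗ V`, that is of `A`-submodules `N` such that `(A ⊗ V) / N` is
projective of constant rank `dim V - r` (used for `r ≤ dim V` only). -/
abbrev grassmannianFunctor (V : Type) [AddCommGroup V] [Module ℂ V] (r : ℕ) :
    CommAlgCat.{0} ℂ ⥤ Type :=
  Module.Grassmannian.functor (R := ℂ) (M := V) (Module.finrank ℂ V - r)

/-- The functor of points of `Z`, on affine schemes: `A ↦ Hom_ℂ(Spec A, Z)`. -/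
abbrev functorOfPoints (Z : SchC) : CommAlgCat.{0} ℂ ⥤ Type :=
  (algSpec (CommRingCat.of ℂ)).rightOp ⋙ yoneda.obj Z

/-- An isomorphism `Z ≅ Gr(r, V)`, as an isomorphism between functors of points: for every
`ℂ`-algebra `A`, morphisms `Spec A ⟶ Z` over `ℂ` are identified, naturally in `A`, with rank `r`
subbundles of `A ⊗ V`. -/
abbrev GrassmannianIso (Z : SchC) (V : Type) [AddCommGroup V] [Module ℂ V] (r : ℕ) :=
  functorOfPoints Z ≅ grassmannianFunctor V r

/-- The structure map `ℂ → Γ(Z, U)`. -/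
def structureMap (Z : SchC) (U : Z.left.Opens) : CommRingCat.of ℂ ⟶ Γ(Z.left, U) :=
  (Scheme.ΓSpecIso (CommRingCat.of ℂ)).inv ≫ Z.hom.appTop ≫
    Z.left.presheaf.map (homOfLE le_top).op

instance (Z : SchC) (U : Z.left.Opens) : Algebra ℂ Γ(Z.left, U) :=
  (structureMap Z U).hom.toAlgebra

/-- Restriction of functions as a map of `ℂ`-algebras. -/
def resAlgHom (Z : SchC) {U U' : Z.left.Opens} (h : U' ≤ U) :
    Γ(Z.left, U) →ₐ[ℂ] Γ(Z.left, U') where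
  toRingHom := (Z.left.presheaf.map (homOfLE h).op).hom
  commutes' c := by
    have : structureMap Z U ≫ Z.left.presheaf.map (homOfLE h).op = structureMap Z U' := by
      simp only [structureMap, Category.assoc, ← Functor.map_comp]
      rfl
    exact congr($(this).hom c)

lemma fromSpec_hom (Z : SchC) {U : Z.left.Opens} (hU : IsAffineOpen U) :
    hU.fromSpec ≫ Z.hom = Spec.map (structureMap Z U) := by
  have h : (Spec (CommRingCat.of ℂ)).toSpecΓ ≫
      Spec.map (Scheme.ΓSpecIso (CommRingCat.of ℂ)).inv = 𝟙 _ := by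
    simp
  simp only [structureMap, Spec.map_comp, Category.assoc]
  rw [← hU.fromSpec_toSpecΓ, Category.assoc, ← Scheme.toSpecΓ_naturality_assoc, h,
    Category.comp_id]

/-- The inclusion of an affine open `U ⊆ Z`, as a point of `Z` with values in `Γ(Z, U)`. -/
def affinePoint (Z : SchC) {U : Z.left.Opens} (hU : IsAffineOpen U) :
    (functorOfPoints Z).obj (CommAlgCat.of ℂ Γ(Z.left, U)) :=
  Over.homMk hU.fromSpec (fromSpec_hom Z hU)

lemma functorOfPoints_map_affinePoint (Z : SchC) {U U' : Z.left.Opens} (hU : IsAffineOpen U)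
    (hU' : IsAffineOpen U') (h : U' ≤ U) :
    (functorOfPoints Z).map (CommAlgCat.ofHom (resAlgHom Z h)) (affinePoint Z hU) =
      affinePoint Z hU' := by
  apply Over.OverMorphism.ext
  exact hU.map_fromSpec hU' (homOfLE h).op

section Tautological

variable {Z : SchC} {V : Type} [AddCommGroup V] [Module ℂ V] {r : ℕ} (e : GrassmannianIso Z V r)

/-- The sections over an affine open `U` of the universal subbundle `S ⊆ 𝒪_Z ⊗ V`. -/
def universalSub {U : Z.left.Opens} (hU : IsAffineOpen U) :
    Submodule Γ(Z.left, U) (Γ(Z.left, U) ⊗[ℂ] V) :=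
  Module.Grassmannian.toSubmodule (e.hom.app _ (affinePoint Z hU))

/-- The restriction of functions with values in `V`. -/
def resTensor (V : Type) [AddCommGroup V] [Module ℂ V] {U U' : Z.left.Opens} (h : U' ≤ U) :
    Γ(Z.left, U) ⊗[ℂ] V →ₗ[ℂ] Γ(Z.left, U') ⊗[ℂ] V :=
  (resAlgHom Z h).toLinearMap.rTensor V

lemma resTensor_mem {U U' : Z.left.Opens} (hU : IsAffineOpen U) (hU' : IsAffineOpen U')
    (h : U' ≤ U) {s : Γ(Z.left, U) ⊗[ℂ] V} (hs : s ∈ universalSub e hU) :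
    resTensor V h s ∈ universalSub e hU' := by
  have nat : (e.hom.app _ (affinePoint Z hU')) =
      Module.Grassmannian.map (resAlgHom Z h) (e.hom.app _ (affinePoint Z hU)) := by
    rw [← functorOfPoints_map_affinePoint Z hU hU' h]
    exact NatTrans.naturality_apply e.hom (CommAlgCat.ofHom (resAlgHom Z h)) (affinePoint Z hU)
  let : Algebra Γ(Z.left, U) Γ(Z.left, U') := (resAlgHom Z h).toAlgebra
  have : IsScalarTower ℂ Γ(Z.left, U) Γ(Z.left, U') :=
    IsScalarTower.of_algebraMap_eq' (resAlgHom Z h).comp_algebraMap.symm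
  unfold universalSub
  rw [nat]
  change Module.Grassmannian.baseChangeMkQ Γ(Z.left, U') (universalSub e hU) (resTensor V h s) = 0
  have key : ∀ t : Γ(Z.left, U) ⊗[ℂ] V,
      Module.Grassmannian.baseChangeMkQ Γ(Z.left, U') (universalSub e hU) (resTensor V h t) =
        1 ⊗ₜ (universalSub e hU).mkQ t := by
    intro t
    induction t using TensorProduct.induction_on with
    | zero => simp
    | tmul a v =>
      have : resTensor V h (a ⊗ₜ v) = (resAlgHom Z h a) ⊗ₜ v := rfl
      rw [this]
      simp only [Module.Grassmannian.baseChangeMkQ, LinearMap.comp_apply]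
      rw [LinearEquiv.coe_coe, TensorProduct.AlgebraTensorModule.cancelBaseChange_symm_tmul]
      have h1 : resAlgHom Z h a = a • (1 : Γ(Z.left, U')) := by
        rw [Algebra.smul_def, mul_one]
        rfl
      rw [LinearMap.baseChange_tmul, h1, TensorProduct.smul_tmul, ← map_smul,
        TensorProduct.smul_tmul', smul_eq_mul, mul_one]
    | add x y hx hy => rw [map_add, map_add, map_add, hx, hy, TensorProduct.tmul_add]
  rw [key, Submodule.mkQ_apply, (Submodule.Quotient.mk_eq_zero _).2 hs, TensorProduct.tmul_zero]

/-- The restriction map `S(U) → S(U')` of the universal subbundle. -/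
def universalSubRes {U U' : Z.left.Opens} (hU : IsAffineOpen U) (hU' : IsAffineOpen U')
    (h : U' ≤ U) : universalSub e hU →ₗ[ℂ] universalSub e hU' :=
  ((resTensor V h).comp ((universalSub e hU).subtype.restrictScalars ℂ)).codRestrict
    ((universalSub e hU').restrictScalars ℂ) fun s => resTensor_mem e hU hU' h s.2

end Tautological

/-! ### The normal bundle -/

section Normal

variable {X Z : SchC} (i : Z ⟶ X)

/-- The ideal of `Z` in `Γ(X, U)`. -/
abbrev idealOn (U : X.left.Opens) : Ideal Γ(X.left, U) :=
  RingHom.ker (i.left.app U).hom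

/-- The restriction map `I(U) → I(U')` of the ideal sheaf of `Z`. -/
def idealRes {U U' : X.left.Opens} (h : U' ≤ U) (x : idealOn i U) : idealOn i U' :=
  ⟨X.left.presheaf.map (homOfLE h).op x.1, by
    have := x.2
    rw [RingHom.mem_ker] at this ⊢
    have nat := congr($(i.left.naturality (homOfLE h).op).hom x.1)
    simp only [CommRingCat.hom_comp, RingHom.comp_apply] at nat
    erw [nat, this, map_zero]⟩

instance (U : X.left.Opens) : Algebra Γ(X.left, U) Γ(Z.left, i.left ⁻¹ᵁ U) :=
  (i.left.app U).hom.toAlgebra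

/-- The sections over `U ∩ Z`, for `U` an affine open in `X`, of the normal sheaf
`N_{Z/X} = Hom(I/I², 𝒪_Z)` of a closed immersion `Z ⟶ X` with ideal sheaf `I`. -/
abbrev normalSections (U : X.left.Opens) : Type :=
  (idealOn i U).Cotangent →ₗ[Γ(X.left, U)] Γ(Z.left, i.left ⁻¹ᵁ U)

/-- An isomorphism of `𝒪_Z`-modules `S ⊗ W^∨ ≅ N_{Z/X}`. -/
structure NormalBundleIso [IsClosedImmersion i.left] {V : Type} [AddCommGroup V] [Module ℂ V]
    {r : ℕ} (e : GrassmannianIso Z V r) (W : Type) [AddCommGroup W] [Module ℂ W] where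
  equiv (U : X.left.Opens) (hU : IsAffineOpen U) :
    (universalSub e (hU.preimage i.left) ⊗[ℂ] Module.Dual ℂ W)
      ≃ₗ[Γ(Z.left, i.left ⁻¹ᵁ U)] normalSections i U
  compatible (U U' : X.left.Opens) (hU : IsAffineOpen U) (hU' : IsAffineOpen U') (h : U' ≤ U)
    (t : universalSub e (hU.preimage i.left) ⊗[ℂ] Module.Dual ℂ W) (x : idealOn i U) :
    equiv U' hU' ((universalSubRes e (hU.preimage i.left) (hU'.preimage i.left)
        (i.left.preimage_mono h)).rTensor _ t) ((idealOn i U').toCotangent (idealRes i h x)) =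
      resAlgHom Z (i.left.preimage_mono h) (equiv U hU t ((idealOn i U).toCotangent x))

end Normal

/-! ### Contractions and semismall maps -/

/-- `φ : X ⟶ Y` contracts exactly the subset `E` to the point `p`: the morphism is proper,
`φ⁻¹(p) = E`, and `φ` is an isomorphism over `Y \ {p}`. -/
structure ContractsToPoint {X Y : Scheme.{0}} (φ : X ⟶ Y) (E : Set X) (p : Y) : Prop where
  proper : IsProper φ
  isClosed : IsClosed ({p} : Set Y)
  preimage_eq : φ ⁻¹' {p} = E
  isIso : IsIso (φ ∣_ (⟨{p}ᶜ, isClosed.isOpen_compl⟩ : Y.Opens))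

/-- A morphism `f : X ⟶ Y` is semismall if it is proper and surjective and, for every `k`,
`dim {y | dim f⁻¹(y) ≥ k} + 2k ≤ dim X` (the empty set has dimension `-∞`). -/
structure IsSemismall {X Y : Scheme.{0}} (f : X ⟶ Y) : Prop where
  proper : IsProper f
  surjective : Function.Surjective f
  dim_le (k : ℕ) :
    topologicalKrullDim {y : Y | (k : WithBot ℕ∞) ≤ topologicalKrullDim (f.fiber y)} + 2 * k ≤
      topologicalKrullDim X

end GrassmannianFlop

end

/-! Both dimensions are computed as ranks of modules of differentials. In characteristic zero a
finitely generated domain has Krull dimension equal to the generic rank of its differentials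
(`ringKrullDim_eq_finrank_kaehlerDifferential`).

The functor-of-points isomorphism covers `Z` by opens of affine spaces of dimension r(n-r), the
spaces of matrices in the standard charts (`exists_isOpenImmersion_affineSpace`). This gives dim Z,
and also the smoothness of `Z`. Smoothness makes the conormal sequence 0 → I/I² → Ω_X|_Z → Ω_Z → 0
locally split exact, so dim X = dim Z + rank N (`finrank_normal_add_finrank_kaehlerDifferential`),
and S ⊗ W^∨ has rank rn.

For semismallness, every fibre away from p is a single point, so for k > 0 the stratum lies in {p},
and the bound there follows from 2 dim Z ≤ dim X, that is 2r(n-r) ≤ r(n-r) + rn. For k = 0 the bound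
is dim Y ≤ dim X, which holds because chains of irreducible closed sets lift along a closed
surjection (`topologicalKrullDim_le_of_isClosedMap`). -/

namespace GrassmannianFlop

open Module Order

/-! ### Commutative algebra: dimension, differentials, ranks and the conormal sequence. -/

section Algebra

/-- Incomparability gives one inequality; lying over followed by going up gives the other. -/
theorem ringKrullDim_eq_of_isIntegral {R S : Type*} [CommRing R] [CommRing S] [Algebra R S]
    [Algebra.IsIntegral R S] (hinj : Function.Injective (algebraMap R S)) :
    ringKrullDim S = ringKrullDim R := by
  apply le_antisymm
  · refine krullDim_le_of_strictMono (PrimeSpectrum.comap (algebraMap R S)) fun p q hpq => ?_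
    exact Ideal.IsIntegral.comap_lt_comap (R := R) (I := p.asIdeal) (J := q.asIdeal) hpq
  · refine iSup_le fun l => ?_
    have : FaithfulSMul R S := (faithfulSMul_iff_algebraMap_injective R S).2 hinj
    obtain ⟨P, hP, hPl⟩ := Ideal.exists_ideal_over_prime_of_isIntegral
      (S := S) l.head.asIdeal (⊥ : Ideal S) (by
        rw [Ideal.comap_bot_of_injective _ hinj]; exact bot_le)
    have : P.LiesOver l.head.asIdeal := ⟨hPl.2.symm⟩
    have := hPl.1
    obtain ⟨L, hL, -⟩ := Ideal.exists_ltSeries_of_hasGoingUp l P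
    rw [← hL]
    exact L.length_le_krullDim

theorem finrank_kaehlerDifferential_of_formallyEtale (k : Type*) {R S : Type*} [CommRing k]
    [CommRing R] [CommRing S] [IsDomain S] [Algebra k R] [Algebra k S] [Algebra R S]
    [IsScalarTower k R S] [Algebra.FormallyEtale R S]
    (hinj : Function.Injective (algebraMap R S)) :
    finrank S Ω[S⁄k] = finrank R Ω[R⁄k] :=
  have : FaithfulSMul R S := (faithfulSMul_iff_algebraMap_injective R S).2 hinj
  (KaehlerDifferential.isBaseChange_of_formallyEtale k R S).finrank_eq

theorem finrank_kaehlerDifferential_mvPolynomial (k σ : Type*) [CommRing k] [Nontrivial k]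
    [Finite σ] : finrank (MvPolynomial σ k) Ω[MvPolynomial σ k⁄k] = Nat.card σ := by
  exact finrank_eq_nat_card_basis (KaehlerDifferential.mvPolynomialBasis k σ)

/-- The dimension of an affine variety in characteristic zero is the generic rank of its module
of differentials. -/
theorem ringKrullDim_eq_finrank_kaehlerDifferential (k : Type*) {A : Type*} [Field k]
    [CharZero k] [CommRing A] [IsDomain A] [Algebra k A] [Algebra.FiniteType k A] :
    ringKrullDim A = finrank A Ω[A⁄k] := by
  -- Noether normalization: `A` is integral over a polynomial ring in `s` variables.
  obtain ⟨s, g, hg, hint⟩ := exists_integral_inj_algHom_of_fg k A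
  let P := MvPolynomial (Fin s) k
  let _ : Algebra P A := g.toRingHom.toAlgebra
  have : IsScalarTower k P A := IsScalarTower.of_algebraMap_eq' g.comp_algebraMap.symm
  have : Algebra.IsIntegral P A := ⟨hint⟩
  let F := FractionRing P
  let L := FractionRing A
  have hPL : Function.Injective (algebraMap P L) := by
    rw [IsScalarTower.algebraMap_eq P A L]
    exact (IsFractionRing.injective A L).comp hg
  have : FaithfulSMul P L := (faithfulSMul_iff_algebraMap_injective P L).2 hPL
  let _ : Algebra F L := FractionRing.liftAlgebra P L
  have : IsScalarTower P F L := FractionRing.isScalarTower_liftAlgebra P L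
  have : CharZero F := charZero_of_injective_algebraMap (algebraMap k F).injective
  have : Algebra.IsAlgebraic F L := by
    have : Algebra.IsAlgebraic A L :=
      (IsFractionRing.comap_isAlgebraic_iff (A := A) (K := L) (C := L)).mpr inferInstance
    have : Algebra.IsAlgebraic P L := Algebra.IsAlgebraic.trans P A L
    exact Algebra.IsAlgebraic.extendScalars (IsFractionRing.injective P F)
  -- Characteristic zero enters here: the algebraic extension `L/F` is separable, so the
  -- differentials of `P` and of `A` have the same rank, that of `Ω[L⁄k]`.
  have : Algebra.FormallyEtale F L := Algebra.FormallyEtale.of_isSeparable F L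
  have : Algebra.FormallyEtale P F := Algebra.FormallyEtale.of_isLocalization (nonZeroDivisors P)
  have : Algebra.FormallyEtale P L := Algebra.FormallyEtale.comp P F L
  have : Algebra.FormallyEtale A L := Algebra.FormallyEtale.of_isLocalization (nonZeroDivisors A)
  have h1 : finrank L Ω[L⁄k] = finrank A Ω[A⁄k] :=
    finrank_kaehlerDifferential_of_formallyEtale k (IsFractionRing.injective A L)
  have h2 : finrank L Ω[L⁄k] = finrank P Ω[P⁄k] :=
    finrank_kaehlerDifferential_of_formallyEtale k hPL
  rw [ringKrullDim_eq_of_isIntegral (R := P) hg, ← h1, h2,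
    finrank_kaehlerDifferential_mvPolynomial]
  simp [P]

theorem rankAtStalk_eq_finrank_of_isDomain {C P : Type*} [CommRing C] [IsDomain C]
    [AddCommGroup P] [Module C P] [Module.Finite C P] [Projective C P] (p : PrimeSpectrum C) :
    rankAtStalk P p = finrank C P := by
  rw [← p.asIdeal.finrank_fiber_eq_finrank, p.asIdeal.finrank_fiber_eq_rankAtStalk]

/-- A finite projective module over a domain has constant rank, so `A → C` need not be injective; it
will be the restriction to a closed subscheme. -/
theorem finrank_baseChange_of_isDomain {A C P : Type*} [CommRing A] [IsDomain A] [CommRing C]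
    [IsDomain C] [Algebra A C] [AddCommGroup P] [Module A P] [Module.Finite A P]
    [Projective A P] : finrank C (C ⊗[A] P) = finrank A P := by
  let p : PrimeSpectrum C := ⊥
  rw [← rankAtStalk_eq_finrank_of_isDomain p, rankAtStalk_baseChange,
    rankAtStalk_eq_finrank_of_isDomain]

/-- Finite presentation lets Hom commute with localization, which reduces to vector spaces over the
fraction field. -/
theorem finrank_dual_of_projective {C P : Type*} [CommRing C] [IsDomain C] [AddCommGroup P]
    [Module C P] [Module.Finite C P] [Projective C P] :
    finrank C (P →ₗ[C] C) = finrank C P := by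
  let K := FractionRing C
  have : FinitePresentation C P := finitePresentation_of_projective C P
  have h1 := IsLocalizedModule.finrank_eq (nonZeroDivisors C)
    (IsLocalizedModule.mapExtendScalars (nonZeroDivisors C) (TensorProduct.mk C K P 1)
      (Algebra.linearMap C K) K) le_rfl
  have h2 : finrank K (K ⊗[C] P) = finrank C P := (TensorProduct.isBaseChange C P K).finrank_eq
  rw [← h1, ← h2, ← IsFractionRing.finrank_right_eq C K]
  exact Subspace.dual_finrank_eq

theorem finite_and_projective_ker {C M Q : Type*} [CommRing C] [AddCommGroup M] [Module C M]
    [AddCommGroup Q] [Module C Q] [Module.Finite C M] [Projective C M] [Projective C Q]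
    (f : M →ₗ[C] Q) (hf : Function.Surjective f) :
    Module.Finite C (LinearMap.ker f) ∧ Projective C (LinearMap.ker f) := by
  obtain ⟨g, hg⟩ := projective_lifting_property f LinearMap.id hf
  have hker : ∀ x, x - g (f x) ∈ LinearMap.ker f := fun x => by
    have := congr($hg (f x))
    simp only [LinearMap.comp_apply, LinearMap.id_apply] at this
    rw [LinearMap.mem_ker, map_sub, this, sub_self]
  let π : M →ₗ[C] LinearMap.ker f := (LinearMap.id - g.comp f).codRestrict _ hker
  have hπ : π.comp (LinearMap.ker f).subtype = LinearMap.id := by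
    ext x
    have := x.2
    rw [LinearMap.mem_ker] at this
    simp [π, this]
  exact ⟨Module.Finite.of_surjective π fun x => ⟨x.1, congr($hπ x)⟩, Projective.of_split _ π hπ⟩

theorem finrank_tensorProduct_of_projective {k C N W : Type*} [Field k] [CommRing C] [IsDomain C]
    [Algebra k C] [AddCommGroup N] [Module C N] [Module k N] [IsScalarTower k C N]
    [Module.Finite C N] [Projective C N] [AddCommGroup W] [Module k W] [FiniteDimensional k W] :
    finrank C (N ⊗[k] W) = finrank C N * finrank k W := by
  have e := AlgebraTensorModule.cancelBaseChange k C C N W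
  have : Module.Finite C (N ⊗[k] W) := Module.Finite.equiv e
  have : Projective C (N ⊗[k] W) := Projective.of_equiv e
  let p : PrimeSpectrum C := ⊥
  rw [← rankAtStalk_eq_finrank_of_isDomain p, rankAtStalk_tensorProduct_of_isScalarTower,
    rankAtStalk_eq_finrank_of_isDomain, rankAtStalk_eq_finrank_of_free]
  rfl

theorem finrank_grassmannian_tensorProduct {k C V W : Type*} [Field k] [CommRing C] [IsDomain C]
    [Algebra k C] [AddCommGroup V] [Module k V] [FiniteDimensional k V] [AddCommGroup W]
    [Module k W] [FiniteDimensional k W] {m : ℕ} (N : Module.Grassmannian C (C ⊗[k] V) m) :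
    finrank C (N.toSubmodule ⊗[k] W) = (finrank k V - m) * finrank k W := by
  have hker := finite_and_projective_ker N.mkQ N.mkQ_surjective
  rw [Submodule.ker_mkQ] at hker
  obtain ⟨_, _⟩ := hker
  let p : PrimeSpectrum C := ⊥
  have h1 := Submodule.finrank_quotient_add_finrank N.toSubmodule
  rw [finrank_baseChange, ← rankAtStalk_eq_finrank_of_isDomain p, N.rankAtStalk_eq] at h1
  refine (finrank_tensorProduct_of_projective (C := C) (N := N.toSubmodule)).trans ?_
  congr 1
  omega

/-- Formal smoothness of `C` splits the conormal map, so I/I² is the kernel of a surjection of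
finite projective modules, and its dual has the same rank. -/
theorem finrank_normal_add_finrank_kaehlerDifferential (k : Type*) {A C : Type*} [Field k]
    [CommRing A] [CommRing C] [IsDomain A] [IsDomain C] [Algebra k A] [Algebra k C]
    [Algebra A C] [IsScalarTower k A C] [Algebra.FiniteType k A] [Algebra.FormallySmooth k A]
    [Algebra.FormallySmooth k C] (hsurj : Function.Surjective (algebraMap A C)) :
    finrank C ((RingHom.ker (algebraMap A C)).Cotangent →ₗ[A] C) + finrank C Ω[C⁄k] =
      finrank A Ω[A⁄k] := by
  let f := KaehlerDifferential.mapBaseChange k A C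
  have hf : Function.Surjective f := KaehlerDifferential.mapBaseChange_surjective k A C hsurj
  have : Module.Finite C Ω[C⁄k] := Module.Finite.of_surjective f hf
  obtain ⟨l, hl⟩ := (Algebra.FormallySmooth.iff_split_injection (R := k) hsurj).1 ‹_›
  have hexact := KaehlerDifferential.exact_kerCotangentToTensor_mapBaseChange k A C hsurj
  let e : (RingHom.ker (algebraMap A C)).Cotangent ≃ₗ[A] LinearMap.ker f :=
    LinearEquiv.ofBijective
      ((KaehlerDifferential.kerCotangentToTensor k A C).codRestrict
        ((LinearMap.ker f).restrictScalars A) fun x => (hexact _).2 ⟨x, rfl⟩)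
      ⟨fun x y h => by
        have h' := congr(l $(congrArg Subtype.val h))
        exact (congr($hl x).symm.trans h').trans congr($hl y),
      fun x => by
        obtain ⟨y, hy⟩ := (hexact x.1).1 x.2
        exact ⟨y, Subtype.ext hy⟩⟩
  obtain ⟨_, _⟩ := finite_and_projective_ker f hf
  -- Since `A → C` is surjective, `A`-linear maps between `C`-modules are `C`-linear.
  let e' : ((RingHom.ker (algebraMap A C)).Cotangent →ₗ[A] C) ≃ₗ[C] (LinearMap.ker f →ₗ[C] C) :=
    { toFun := fun φ => LinearMap.extendScalarsOfSurjective hsurj (φ ∘ₗ e.symm.toLinearMap)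
      invFun := fun ψ => ψ.restrictScalars A ∘ₗ e.toLinearMap
      map_add' := fun _ _ => rfl
      map_smul' := fun _ _ => rfl
      left_inv := fun φ => by
        ext x
        exact congrArg φ (e.symm_apply_apply _)
      right_inv := fun ψ => by
        ext x
        exact congrArg ψ (e.apply_symm_apply _) }
  have hdual := e'.finrank_eq.trans (finrank_dual_of_projective (C := C) (P := LinearMap.ker f))
  rw [hdual, add_comm,
    ← finrank_baseChange_of_isDomain (A := A) (C := C),
    ← (LinearMap.quotKerEquivOfSurjective f hf).finrank_eq]
  exact Submodule.finrank_quotient_add_finrank _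

end Algebra

end GrassmannianFlop

namespace GrassmannianFlop

open Module Order TopologicalSpace

/-! ### Krull dimension of spaces: locality, and closed surjections. -/

section Topology

/-- The dimension is the supremum of the coheights of irreducible closed sets, and coheight can be
computed inside any open set meeting the given one. -/
theorem topologicalKrullDim_eq_of_forall_exists_isOpen {X : Type*} [TopologicalSpace X]
    [Nonempty X] {d : WithBot ℕ∞}
    (h : ∀ x : X, ∃ U : Set X, IsOpen U ∧ x ∈ U ∧ topologicalKrullDim U = d) :
    topologicalKrullDim X = d := by
  apply le_antisymm
  · obtain ⟨x⟩ := ‹Nonempty X›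
    have : Nonempty (IrreducibleCloseds X) :=
      ⟨⟨closure {x}, isIrreducible_singleton.closure, isClosed_closure⟩⟩
    rw [topologicalKrullDim, krullDim_eq_iSup_coheight]
    refine iSup_le fun Z => ?_
    obtain ⟨z, hz⟩ := Z.isIrreducible.nonempty
    obtain ⟨U, hU, hzU, rfl⟩ := h z
    have hemb : Topology.IsOpenEmbedding (Subtype.val : U → X) := hU.isOpenEmbedding_subtypeVal
    let Z' := (IrreducibleCloseds.orderIsoOfIsOpenEmbedding _ hemb).symm
      ⟨Z, ⟨⟨z, hzU⟩, hz⟩⟩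
    have hZ' : IrreducibleCloseds.map (Subtype.val : U → X) hemb.continuous Z' = Z :=
      congrArg Subtype.val ((IrreducibleCloseds.orderIsoOfIsOpenEmbedding _ hemb).apply_symm_apply _)
    rw [← hZ', hemb.coheight_map]
    exact coheight_le_krullDim Z'
  · obtain ⟨x⟩ := ‹Nonempty X›
    obtain ⟨U, -, -, rfl⟩ := h x
    exact topologicalKrullDim_subspace_le X U

/-- Lift the generic point of `T` to a point of `S` and take its closure. -/
theorem exists_isGenericPoint_of_isClosedMap {X Y : Type*} [TopologicalSpace X]
    [TopologicalSpace Y] [QuasiSober Y] {f : X → Y} (hf : Continuous f) (hcl : IsClosedMap f)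
    {S : Set X} (hS : IsClosed S) (T : IrreducibleCloseds Y) (hT : (T : Set Y) ⊆ f '' S) :
    ∃ S' : IrreducibleCloseds X, (S' : Set X) ⊆ S ∧ f '' S' = T := by
  obtain ⟨y, hy⟩ := QuasiSober.sober T.isIrreducible T.isClosed
  obtain ⟨x, hx, rfl⟩ := hT hy.mem
  refine ⟨⟨closure {x}, isIrreducible_singleton.closure, isClosed_closure⟩,
    hS.closure_subset_iff.2 (by simpa using hx), ?_⟩
  change f '' closure {x} = T
  rw [← hcl.closure_image_eq_of_continuous hf, Set.image_singleton]
  exact hy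

theorem topologicalKrullDim_le_of_isClosedMap {X Y : Type*} [TopologicalSpace X]
    [TopologicalSpace Y] [QuasiSober Y] {f : X → Y} (hf : Continuous f)
    (hcl : IsClosedMap f) (hsurj : Function.Surjective f) :
    topologicalKrullDim Y ≤ topologicalKrullDim X := by
  -- Chains are lifted from the top down, each new member being found inside the lift of the next
  -- larger one.
  have key : ∀ l : LTSeries (IrreducibleCloseds Y), ∀ S : IrreducibleCloseds X,
      f '' S = l.last → ∃ L : LTSeries (IrreducibleCloseds X), L.length = l.length ∧ L.last = S := by
    intro l
    induction l using RelSeries.inductionOn' with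
    | singleton T => exact fun S _ => ⟨RelSeries.singleton _ S, rfl, rfl⟩
    | snoc l T hlt ih =>
      intro S hS
      rw [RelSeries.last_snoc] at hS
      have hlt' : l.last < T := hlt
      obtain ⟨S', hle, hS'⟩ := exists_isGenericPoint_of_isClosedMap hf hcl S.isClosed l.last
        (hS ▸ hlt'.le)
      obtain ⟨L, hL, rfl⟩ := ih S' hS'
      refine ⟨L.snoc S (lt_of_le_of_ne hle fun h => ?_), by
        change L.length + 0 + 1 = l.length + 0 + 1
        rw [hL], RelSeries.last_snoc ..⟩
      rw [h, hS] at hS'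
      exact hlt'.ne (SetLike.coe_injective hS'.symm)
  refine iSup_le fun l => ?_
  obtain ⟨S, -, hS⟩ := exists_isGenericPoint_of_isClosedMap hf hcl isClosed_univ l.last
    (by rw [Set.image_univ_of_surjective hsurj]; exact Set.subset_univ _)
  obtain ⟨L, hL, -⟩ := key l S hS
  rw [← hL]
  exact L.length_le_krullDim

end Topology
end GrassmannianFlop

namespace GrassmannianFlop

open Module Order TopologicalSpace

/-! ### Semismallness of a contraction to a point. -/

section Semismall

theorem topologicalKrullDim_le_zero_of_subsingleton (X : Type*) [TopologicalSpace X]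
    [Subsingleton X] : topologicalKrullDim X ≤ 0 :=
  topologicalKrullDim_zero_of_discreteTopology X

namespace ContractsToPoint

variable {X Y : Scheme.{0}} {φ : X ⟶ Y} {E : Set X} {p : Y}

theorem existsUnique (h : ContractsToPoint φ E p) {y : Y} (hy : y ≠ p) : ∃! x, φ x = y := by
  have := h.isIso
  let U : Y.Opens := ⟨{p}ᶜ, h.isClosed.isOpen_compl⟩
  have hbij : Function.Bijective (φ ∣_ U) := (φ ∣_ U).homeomorph.bijective
  have hcoe (x : (φ ⁻¹ᵁ U : X.Opens)) : ((φ ∣_ U) x).1 = φ x.1 := morphismRestrict_base_coe φ U x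
  obtain ⟨x, hx⟩ := hbij.2 ⟨y, hy⟩
  refine ⟨x.1, (hcoe x).symm.trans congr(($hx).1), fun x' hx' => ?_⟩
  have hx'U : x' ∈ φ ⁻¹ᵁ U := by
    change φ x' ≠ p
    exact hx' ▸ hy
  have : (⟨x', hx'U⟩ : (φ ⁻¹ᵁ U : X.Opens)) = x := hbij.1 (by
    rw [hx]
    exact Subtype.ext ((hcoe _).trans hx'))
  exact congr(($this).1)

theorem isSemismall (h : ContractsToPoint φ E p) (hE : E.Nonempty)
    (hdim : 2 * topologicalKrullDim E ≤ topologicalKrullDim X) : IsSemismall φ := by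
  have := h.proper
  have hsurj : Function.Surjective φ := fun y => by
    by_cases hy : y = p
    · obtain ⟨x, hx⟩ := hE
      rw [← h.preimage_eq] at hx
      exact ⟨x, hx.trans hy.symm⟩
    · exact (h.existsUnique hy).exists
  refine ⟨h.proper, hsurj, fun k => ?_⟩
  obtain rfl | hk := Nat.eq_zero_or_pos k
  · simp only [Nat.cast_zero, mul_zero, add_zero]
    exact (topologicalKrullDim_subspace_le Y _).trans
      (topologicalKrullDim_le_of_isClosedMap φ.continuous φ.isClosedMap hsurj)
  set S : Set Y := {y | (k : WithBot ℕ∞) ≤ topologicalKrullDim (φ.fiber y)} with hS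
  have hfib (y : Y) : topologicalKrullDim (φ.fiber y) = topologicalKrullDim (φ ⁻¹' {y}) :=
    IsHomeomorph.topologicalKrullDim_eq _ (φ.fiberHomeo y).isHomeomorph
  -- Away from `p` the fibre is one point, of dimension less than `k`.
  have hSp : S ⊆ {p} := fun y hy => by
    by_contra hyp
    obtain ⟨x, -, hx⟩ := h.existsUnique hyp
    have : Subsingleton (φ ⁻¹' {y}) :=
      ⟨fun a b => Subtype.ext ((hx _ a.2).trans (hx _ b.2).symm)⟩
    have h1 : (k : WithBot ℕ∞) ≤ 0 := by
      rw [hS, Set.mem_ofPred_eq, hfib] at hy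
      exact hy.trans (topologicalKrullDim_le_zero_of_subsingleton _)
    have h2 : k ≤ 0 := by exact_mod_cast h1
    omega
  have : Subsingleton S := Set.subsingleton_coe _ |>.2 (Set.subsingleton_singleton.anti hSp)
  obtain hemp | ⟨y, hy⟩ := S.eq_empty_or_nonempty
  -- An empty stratum has dimension `⊥`, which absorbs the summand 2k.
  · have : IsEmpty (IrreducibleCloseds S) := ⟨fun T => by
      obtain ⟨x, -⟩ := T.isIrreducible.nonempty
      exact Set.eq_empty_iff_forall_notMem.1 hemp x.1 x.2⟩
    rw [topologicalKrullDim, krullDim_eq_bot, WithBot.bot_add]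
    exact bot_le
  · have hyp : y = p := hSp hy
    rw [hS, Set.mem_ofPred_eq, hfib, hyp, h.preimage_eq] at hy
    calc topologicalKrullDim S + 2 * k ≤ 0 + 2 * k :=
          add_le_add_left (topologicalKrullDim_le_zero_of_subsingleton S) _
      _ = 2 * k := zero_add _
      _ ≤ 2 * topologicalKrullDim E := by gcongr
      _ ≤ _ := hdim

end ContractsToPoint

end Semismall
end GrassmannianFlop

namespace GrassmannianFlop

open Module

/-! ### Matrix charts of the Grassmannian over a fixed ring. -/

section Chart

set_option linter.unusedSectionVars false

variable {k : Type*} [Field k] {V : Type*} [AddCommGroup V] [Module k V]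
variable {σ τ : Type*} [Fintype τ] (b : Basis (σ ⊕ τ) k V)
variable {A : Type*} [CommRing A] [Algebra k A]

open Classical in
/-- The retraction of `A ⊗ V` onto the span of `b (inr t)`, with matrix `x` on the complement. -/
noncomputable def chartMap (x : σ × τ → A) : A ⊗[k] V →ₗ[A] (τ → A) :=
  (b.baseChange A).constr A (Sum.elim (fun s t => x (s, t)) fun t => Pi.single t 1)

@[simp] theorem chartMap_inl (x : σ × τ → A) (s : σ) :
    chartMap b x (1 ⊗ₜ b (.inl s)) = fun t => x (s, t) := by
  classical
  rw [← Basis.baseChange_apply A b, chartMap, Basis.constr_basis]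
  rfl

open Classical in
@[simp] theorem chartMap_inr (x : σ × τ → A) (t : τ) :
    chartMap b x (1 ⊗ₜ b (.inr t)) = Pi.single t 1 := by
  rw [← Basis.baseChange_apply A b, chartMap, Basis.constr_basis]
  simp

theorem chartMap_surjective (x : σ × τ → A) : Function.Surjective (chartMap b x) := by
  classical
  rw [← LinearMap.range_eq_top, ← top_le_iff, ← (Pi.basisFun A τ).span_eq, Submodule.span_le]
  rintro _ ⟨t, rfl⟩
  exact ⟨1 ⊗ₜ b (.inr t), by simp⟩

/-- The point of the Grassmannian with coordinates `x` in the chart given by the basis `b`. -/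
noncomputable def chartPoint {m : ℕ} (hm : Fintype.card τ = m) (x : σ × τ → A) :
    Grassmannian A (A ⊗[k] V) m :=
  letI e := (chartMap b x).quotKerEquivOfSurjective (chartMap_surjective b x)
  { toSubmodule := LinearMap.ker (chartMap b x)
    finite_quotient := Module.Finite.equiv e.symm
    projective_quotient := Projective.of_equiv e.symm
    rankAtStalk_eq := fun p => by
      have := p.nontrivial
      rw [rankAtStalk_eq_of_equiv e, rankAtStalk_eq_finrank_of_free]
      simp [hm] }

variable {m : ℕ} (hm : Fintype.card τ = m)

/-- The images of the vectors `b (inr t)` form a basis of the quotient by `N`. -/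
def IsInChart (N : Submodule A (A ⊗[k] V)) : Prop :=
  ∃ β : Basis τ A ((A ⊗[k] V) ⧸ N), ∀ t, β t = N.mkQ (1 ⊗ₜ b (.inr t))

theorem isInChart_chartPoint (x : σ × τ → A) : IsInChart b (chartPoint b hm x).toSubmodule := by
  classical
  let e := (chartMap b x).quotKerEquivOfSurjective (chartMap_surjective b x)
  refine ⟨(Pi.basisFun A τ).map e.symm, fun t => ?_⟩
  change e.symm (Pi.basisFun A τ t) = Submodule.Quotient.mk _
  rw [Pi.basisFun_apply, LinearEquiv.symm_apply_eq]
  exact (chartMap_inr b x t).symm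

/-- Coordinates in the basis of the quotient turn the quotient map into a `chartMap`. -/
theorem exists_chartPoint_eq (N : Grassmannian A (A ⊗[k] V) m)
    (hN : IsInChart b N.toSubmodule) : ∃ x, chartPoint b hm x = N := by
  classical
  obtain ⟨β, hβ⟩ := hN
  let e := β.equivFun
  let ρ : A ⊗[k] V →ₗ[A] (τ → A) := e.toLinearMap ∘ₗ N.mkQ
  refine ⟨fun p => ρ (1 ⊗ₜ b (.inl p.1)) p.2, Grassmannian.ext ?_⟩
  have hρ : chartMap b (fun p => ρ (1 ⊗ₜ b (.inl p.1)) p.2) = ρ := by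
    refine (b.baseChange A).ext fun i => ?_
    rw [Basis.baseChange_apply]
    cases i with
    | inl s => rw [chartMap_inl]
    | inr t =>
      rw [chartMap_inr]
      change _ = e (N.mkQ (1 ⊗ₜ b (.inr t)))
      rw [← hβ]
      ext t'
      simp [e, Pi.single_apply, eq_comm]
  change LinearMap.ker (chartMap b _) = _
  rw [hρ, LinearEquiv.ker_comp, Submodule.ker_mkQ]

/-- The matrix can be read off from relations in the submodule; this yields both injectivity of the
chart and its compatibility with base change. -/
theorem chartMap_eq_of_mem (x : σ × τ → A) (s : σ) (c : τ → A)
    (h : (1 ⊗ₜ b (.inl s) - ∑ t, c t • (1 ⊗ₜ[k] b (.inr t)) : A ⊗[k] V) ∈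
      (chartPoint b hm x).toSubmodule) (t : τ) : x (s, t) = c t := by
  classical
  have h' := LinearMap.mem_ker.1 h
  rw [map_sub, sub_eq_zero] at h'
  simpa [Finset.sum_apply, Pi.single_apply] using congrFun h' t

theorem mem_chartPoint (x : σ × τ → A) (s : σ) :
    (1 ⊗ₜ b (.inl s) - ∑ t, x (s, t) • (1 ⊗ₜ[k] b (.inr t)) : A ⊗[k] V) ∈
      (chartPoint b hm x).toSubmodule := by
  classical
  refine LinearMap.mem_ker.2 ?_
  ext t
  simp [Finset.sum_apply, Pi.single_apply]

theorem chartPoint_injective : Function.Injective (chartPoint (A := A) b hm) := by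
  intro x y hxy
  ext ⟨s, t⟩
  have h := mem_chartPoint b hm x s
  rw [hxy] at h
  exact (chartMap_eq_of_mem b hm y s _ h t).symm

end Chart

/-! ### Base change of charts. -/

section BaseChange

set_option linter.unusedSectionVars false

variable {k : Type*} [Field k] {V : Type*} [AddCommGroup V] [Module k V]
variable {σ τ : Type*} [Fintype τ] (b : Basis (σ ⊕ τ) k V)
universe u

variable {A B : Type u} [CommRing A] [Algebra k A] [CommRing B] [Algebra k B]

theorem baseChangeMkQ_one_tmul [Algebra A B] [IsScalarTower k A B] (N : Submodule A (A ⊗[k] V))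
    (v : V) : Grassmannian.baseChangeMkQ B N (1 ⊗ₜ v) = (1 : B) ⊗ₜ[A] N.mkQ (1 ⊗ₜ v) := by
  simp [Grassmannian.baseChangeMkQ]

/-- A basis of the base change of the quotient gives a point in the chart. -/
theorem isInChart_ker_baseChangeMkQ [Algebra A B] [IsScalarTower k A B]
    (N : Submodule A (A ⊗[k] V)) (β : Basis τ B (B ⊗[A] ((A ⊗[k] V) ⧸ N)))
    (hβ : ∀ t, β t = 1 ⊗ₜ N.mkQ (1 ⊗ₜ b (.inr t))) :
    IsInChart b (LinearMap.ker (Grassmannian.baseChangeMkQ B N)) := by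
  let e : ((B ⊗[k] V) ⧸ LinearMap.ker (Grassmannian.baseChangeMkQ B N)) ≃ₗ[B] _ :=
    Grassmannian.baseChangeMkQEquiv N
  refine ⟨β.map e.symm, fun t => ?_⟩
  rw [Basis.map_apply, hβ, LinearEquiv.symm_apply_eq, ← baseChangeMkQ_one_tmul]
  rfl

theorem map_chartPoint {m : ℕ} (hm : Fintype.card τ = m) (f : A →ₐ[k] B) (x : σ × τ → A) :
    Grassmannian.map f (chartPoint b hm x) = chartPoint b hm (f ∘ x) := by
  let _ : Algebra A B := f.toAlgebra
  have : IsScalarTower k A B := IsScalarTower.of_algebraMap_eq' f.comp_algebraMap.symm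
  set N := chartPoint b hm x with hN
  have hchart : IsInChart b (Grassmannian.map f N).toSubmodule := by
    obtain ⟨β, hβ⟩ := isInChart_chartPoint b hm x
    exact isInChart_ker_baseChangeMkQ b N.toSubmodule (β.baseChange B) fun t => by
      rw [Basis.baseChange_apply, hβ]
  obtain ⟨y, hy⟩ := exists_chartPoint_eq b hm _ hchart
  rw [← hy]
  congr 1
  ext ⟨s, t⟩
  refine chartMap_eq_of_mem b hm y s (fun t => f (x (s, t))) ?_ t
  rw [hy]
  change Grassmannian.baseChangeMkQ B N.toSubmodule _ = 0
  have h0 := (Submodule.Quotient.mk_eq_zero _).2 (mem_chartPoint b hm x s)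
  rw [← Submodule.mkQ_apply, map_sub, map_sum, sub_eq_zero] at h0
  rw [map_sub, map_sum, baseChangeMkQ_one_tmul, h0, sub_eq_zero, TensorProduct.tmul_sum]
  refine Finset.sum_congr rfl fun t _ => ?_
  rw [map_smul, map_smul, baseChangeMkQ_one_tmul, TensorProduct.tmul_smul,
    TensorProduct.smul_tmul', TensorProduct.smul_tmul', Algebra.smul_def, smul_eq_mul]
  rfl

end BaseChange
end GrassmannianFlop

namespace GrassmannianFlop

open Module

/-! ### Spreading out: charts cover the Grassmannian locally. -/

section Spreading

universe w

/-- A family in a finitely presented module which is a basis after localizing at a prime is a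
basis after inverting one element outside of the prime. -/
theorem exists_basis_localization_of_basis_atPrime {A Q κ : Type*} [CommRing A] [AddCommGroup Q]
    [Module A Q] [FinitePresentation A Q] [Finite κ] (p : Ideal A) [p.IsPrime] (v : κ → Q)
    (β : Basis κ (Localization.AtPrime p) (LocalizedModule p.primeCompl Q))
    (hβ : ∀ t, β t = LocalizedModule.mkLinearMap p.primeCompl Q (v t)) :
    ∃ g ∉ p, ∀ (B : Type w) [CommRing B] [Algebra A B] [IsLocalization.Away g B],
      ∃ γ : Basis κ B (B ⊗[A] Q), ∀ t, γ t = 1 ⊗ₜ v t := by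
  let f : (κ →₀ A) →ₗ[A] Q := Finsupp.linearCombination A v
  have hmap : IsLocalizedModule.map p.primeCompl
      (Finsupp.mapRange.linearMap (Algebra.linearMap A (Localization.AtPrime p)))
      (LocalizedModule.mkLinearMap p.primeCompl Q) f =
        β.repr.symm.toLinearMap.restrictScalars A := by
    refine IsLocalizedModule.ext p.primeCompl
      (Finsupp.mapRange.linearMap (Algebra.linearMap A (Localization.AtPrime p)))
      (IsLocalizedModule.map_units (LocalizedModule.mkLinearMap p.primeCompl Q)) ?_
    rw [IsLocalizedModule.map_comp]
    ext t
    simp [f, hβ]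
  -- Bijectivity at `p` of a map of finitely presented modules persists after inverting one element.
  obtain ⟨g, hg, hbij⟩ := FinitePresentation.exists_notMem_bijective f p
    (Finsupp.mapRange.linearMap (Algebra.linearMap A (Localization.AtPrime p)))
    (LocalizedModule.mkLinearMap p.primeCompl Q) (by
      rw [hmap]
      exact β.repr.symm.bijective)
  refine ⟨g, hg, fun B _ _ _ => ?_⟩
  let fM : (κ →₀ A) →ₗ[A] (κ →₀ B) := Finsupp.mapRange.linearMap (Algebra.linearMap A B)
  let fN : Q →ₗ[A] B ⊗[A] Q := TensorProduct.mk A B Q 1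
  have hbij' : Function.Bijective (IsLocalizedModule.map (Submonoid.powers g) fM fN f) :=
    (IsLocalizedModule.map_bijective_iff_localizedModuleMap_bijective fM fN).2 hbij
  let e : (κ →₀ B) ≃ₗ[B] B ⊗[A] Q := LinearEquiv.ofBijective
    (IsLocalizedModule.mapExtendScalars (Submonoid.powers g) fM fN B f) hbij'
  refine ⟨Basis.ofRepr e.symm, fun t => ?_⟩
  have h1 : IsLocalizedModule.map (Submonoid.powers g) fM fN f (fM (Finsupp.single t 1)) =
      fN (f (Finsupp.single t 1)) := IsLocalizedModule.map_apply ..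
  change e (Finsupp.single t 1) = 1 ⊗ₜ v t
  have h2 : fM (Finsupp.single t 1) = Finsupp.single t 1 := by simp [fM]
  have h3 : f (Finsupp.single t 1) = v t := by simp [f]
  rw [h2, h3] at h1
  exact h1

/-- Every point of the Grassmannian lies locally in one of the charts given by a partition of a
fixed basis. -/
theorem exists_isInChart_localization {k : Type*} [Field k] {V : Type*} [AddCommGroup V]
    [Module k V] {ι : Type} [Finite ι] (b : Basis ι k V) {A : Type} [CommRing A] [Algebra k A] {m : ℕ}
    (N : Grassmannian A (A ⊗[k] V) m) (p : Ideal A) [p.IsPrime] :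
    ∃ (σ τ : Type) (_ : Finite σ) (_ : Fintype τ) (b' : Basis (σ ⊕ τ) k V), Fintype.card τ = m ∧
      ∃ g ∉ p, ∀ (B : Type) [CommRing B] [Algebra k B] [Algebra A B] [IsScalarTower k A B]
        [IsLocalization.Away g B],
        IsInChart b' (LinearMap.ker (Grassmannian.baseChangeMkQ B N.toSubmodule)) := by
  let Ap := Localization.AtPrime p
  let Q := (A ⊗[k] V) ⧸ N.toSubmodule
  have : FinitePresentation A Q := finitePresentation_of_projective A Q
  let Qp := LocalizedModule p.primeCompl Q
  let v : ι → Q := fun i => N.mkQ (1 ⊗ₜ b i)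
  have hv : Submodule.span A (Set.range v) = ⊤ := by
    have : Set.range v = N.mkQ '' Set.range (b.baseChange A) := by
      rw [← Set.range_comp]
      congr 1
      ext i
      simp [v]
    rw [this, Submodule.span_image, (b.baseChange A).span_eq, Submodule.map_top,
      Submodule.range_mkQ]
  have hvp : Submodule.span Ap (Set.range fun i => LocalizedModule.mkLinearMap p.primeCompl Q (v i))
      = ⊤ := by
    rw [Set.range_comp' (LocalizedModule.mkLinearMap p.primeCompl Q) v]
    exact span_eq_top_of_isLocalizedModule Ap p.primeCompl _ hv
  -- Over a local ring, a generating family of the free quotient contains a basis; its index set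
  -- becomes `τ` and the complement becomes `σ`.
  obtain ⟨κ, a, β, hβ⟩ := exists_basis_of_span_of_flat (R := Ap) _ hvp
  have ha : Function.Injective a := fun s t hst => β.injective (by rw [hβ, hβ, hst])
  have : Finite κ := Finite.of_injective a ha
  have := Fintype.ofFinite κ
  let s := Set.range a
  obtain ⟨g, hg, H⟩ := exists_basis_localization_of_basis_atPrime p (v ∘ a) β hβ
  classical
  let E : ι ≃ (sᶜ : Set ι) ⊕ κ := (Equiv.Set.sumCompl s).symm.trans <|
    (Equiv.sumComm _ _).trans (Equiv.sumCongr (Equiv.refl _) (Equiv.ofInjective a ha).symm)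
  have hE (t : κ) : E.symm (.inr t) = a t := by
    simp only [E, Equiv.symm_trans_apply, Equiv.sumCongr_symm, Equiv.symm_symm]
    rfl
  refine ⟨(sᶜ : Set ι), κ, inferInstance, inferInstance, b.reindex E, ?_, g, hg,
    fun B _ _ _ _ _ => ?_⟩
  · rw [← N.rankAtStalk_eq ⟨p, ‹_›⟩, rankAtStalk, finrank_eq_card_basis β]
  · obtain ⟨γ, hγ⟩ := H B
    refine isInChart_ker_baseChangeMkQ _ N.toSubmodule γ fun t => ?_
    rw [hγ, Basis.reindex_apply, hE]
    rfl

end Spreading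

end GrassmannianFlop

namespace GrassmannianFlop

open Module

/-! ### From charts of the functor to open subschemes of affine space. -/

section SchemeChart

variable {Z : SchC} {V : Type} [AddCommGroup V] [Module ℂ V] {r : ℕ} (e : GrassmannianIso Z V r)

theorem hom_app_affinePoint_of_le {U U' : Z.left.Opens} (hU : IsAffineOpen U)
    (hU' : IsAffineOpen U') (h : U' ≤ U) :
    e.hom.app _ (affinePoint Z hU') =
      Grassmannian.map (resAlgHom Z h) (e.hom.app _ (affinePoint Z hU)) := by
  rw [← functorOfPoints_map_affinePoint Z hU hU' h]
  exact NatTrans.naturality_apply e.hom (CommAlgCat.ofHom (resAlgHom Z h)) (affinePoint Z hU)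

theorem hom_app_inv_app (B : CommAlgCat ℂ) (y : (grassmannianFunctor V r).obj B) :
    e.hom.app B (e.inv.app B y) = y :=
  congr(ConcreteCategory.hom $(e.inv_hom_id_app B) y)

theorem inv_app_hom_app (B : CommAlgCat ℂ) (y : (functorOfPoints Z).obj B) :
    e.inv.app B (e.hom.app B y) = y :=
  congr(ConcreteCategory.hom $(e.hom_inv_id_app B) y)

variable {σ τ : Type} [Fintype τ] (b : Basis (σ ⊕ τ) ℂ V)
  (hτ : Fintype.card τ = finrank ℂ V - r)

/-- The affine space with coordinate functions `x (s, t)`, as a scheme over `ℂ`. -/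
noncomputable abbrev chartSpace (σ τ : Type) : SchC :=
  (algSpec (CommRingCat.of ℂ)).obj (.op (CommAlgCat.of ℂ (MvPolynomial (σ × τ) ℂ)))

/-- The morphism from affine space to `Z ≅ Gr(r, V)` given by the chart of the basis `b`. -/
noncomputable def chartMorphism : chartSpace σ τ ⟶ Z :=
  e.inv.app (CommAlgCat.of ℂ (MvPolynomial (σ × τ) ℂ)) (chartPoint b hτ MvPolynomial.X)

theorem algSpec_map_chartMorphism (B : Type) [CommRing B] [Algebra ℂ B] (x : σ × τ → B) :
    (algSpec (CommRingCat.of ℂ)).map (CommAlgCat.ofHom (MvPolynomial.aeval x)).op ≫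
      chartMorphism e b hτ = e.inv.app (CommAlgCat.of ℂ B) (chartPoint b hτ x) := by
  have h := NatTrans.naturality_apply e.inv (CommAlgCat.ofHom (MvPolynomial.aeval (R := ℂ) x))
    (chartPoint b hτ MvPolynomial.X)
  refine h.symm.trans (congrArg (e.inv.app (CommAlgCat.of ℂ B)) ?_)
  refine (map_chartPoint b hτ (MvPolynomial.aeval x) MvPolynomial.X).trans ?_
  congr 1
  ext p
  simp

theorem algSpec_hom_ext_chartMorphism (B : Type) [CommRing B] [Algebra ℂ B]
    (f g : (algSpec (CommRingCat.of ℂ)).obj (.op (CommAlgCat.of ℂ B)) ⟶ chartSpace σ τ)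
    (h : f ≫ chartMorphism e b hτ = g ≫ chartMorphism e b hτ) : f = g := by
  obtain ⟨f, rfl⟩ : ∃ u, (algSpec (CommRingCat.of ℂ)).map u = f :=
    ⟨_, algSpec.fullyFaithful.map_preimage f⟩
  obtain ⟨g, rfl⟩ : ∃ u, (algSpec (CommRingCat.of ℂ)).map u = g :=
    ⟨_, algSpec.fullyFaithful.map_preimage g⟩
  have key (f : (Opposite.op (CommAlgCat.of ℂ B)) ⟶
      .op (CommAlgCat.of ℂ (MvPolynomial (σ × τ) ℂ))) :
      f = (CommAlgCat.ofHom (MvPolynomial.aeval fun p => f.unop.hom (MvPolynomial.X p))).op := by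
    apply Quiver.Hom.unop_inj
    apply CommAlgCat.hom_ext
    ext p
    simp
  rw [key f, key g] at h ⊢
  rw [algSpec_map_chartMorphism, algSpec_map_chartMorphism] at h
  have h' := congrArg (e.hom.app (CommAlgCat.of ℂ B)) h
  have hfg := (hom_app_inv_app e _ _).symm.trans (h'.trans (hom_app_inv_app e _ _))
  rw [chartPoint_injective b hτ hfg]

/-- Testing on affine covers reduces this to injectivity of `chartPoint` on `ℂ`-algebras. -/
theorem mono_chartMorphism_left : Mono (chartMorphism e b hτ).left := by
  constructor
  intro T f g hfg
  refine Scheme.Cover.hom_ext T.affineOpenCover.openCover _ _ fun i => ?_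
  let R : CommRingCat := T.affineOpenCover.X i
  let q : Spec R ⟶ T := T.affineOpenCover.f i
  change q ≫ f = q ≫ g
  have hfg' : (q ≫ f) ≫ (chartMorphism e b hτ).left = (q ≫ g) ≫ (chartMorphism e b hτ).left := by
    rw [Category.assoc, Category.assoc, hfg]
  let c : CommRingCat.of ℂ ⟶ R := Spec.preimage ((q ≫ f) ≫ (chartSpace σ τ).hom)
  let _ : Algebra ℂ R := c.hom.toAlgebra
  have hc : Spec.map c = (q ≫ f) ≫ (chartSpace σ τ).hom := Spec.map_preimage _
  -- The chart is a morphism over `ℂ`, so `f` and `g` induce the same `ℂ`-structure on `R`.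
  have hc' : Spec.map c = (q ≫ g) ≫ (chartSpace σ τ).hom := by
    rw [hc, ← Over.w (chartMorphism e b hτ), ← Category.assoc, hfg', Category.assoc]
  let F : (algSpec (CommRingCat.of ℂ)).obj (.op (CommAlgCat.of ℂ R)) ⟶ chartSpace σ τ :=
    Over.homMk (q ≫ f) hc.symm
  let G : (algSpec (CommRingCat.of ℂ)).obj (.op (CommAlgCat.of ℂ R)) ⟶ chartSpace σ τ :=
    Over.homMk (q ≫ g) hc'.symm
  have hFG : F = G := algSpec_hom_ext_chartMorphism e b hτ R F G
    (Over.OverMorphism.ext hfg')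
  exact congrArg CommaMorphism.left hFG

/-- Around every point, `Z ≅ Gr(r, V)` is an open subscheme of an affine space. -/
theorem exists_isOpenImmersion_affineSpace {Z : SchC} {V : Type} [AddCommGroup V] [Module ℂ V]
    [FiniteDimensional ℂ V] {r : ℕ} (e : GrassmannianIso Z V r) (z : Z.left) :
    ∃ (U : Z.left.Opens) (_ : IsAffineOpen U) (_ : z ∈ U) (σ τ : Type) (_ : Finite σ)
      (_ : Finite τ) (f : MvPolynomial (σ × τ) ℂ →ₐ[ℂ] Γ(Z.left, U)),
      Nat.card τ = finrank ℂ V - r ∧ Nat.card σ + Nat.card τ = finrank ℂ V ∧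
      IsOpenImmersion (Spec.map (CommRingCat.ofHom f.toRingHom)) := by
  obtain ⟨_, ⟨U, hU, rfl⟩, hzU, -⟩ :=
    Z.left.isBasis_affineOpens.exists_subset_of_mem_open (Set.mem_univ z) isOpen_univ
  let N := e.hom.app _ (affinePoint Z hU)
  let p := hU.primeIdealOf ⟨z, hzU⟩
  obtain ⟨σ, τ, _, _, b, hτ, g, hg, H⟩ :=
    exists_isInChart_localization (finBasis ℂ V) N p.asIdeal
  let U' := Z.left.basicOpen g
  have hle : U' ≤ U := Z.left.basicOpen_le g
  have hU' : IsAffineOpen U' := hU.basicOpen g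
  have hz : z ∈ U' := by
    have h1 : p ∈ hU.fromSpec ⁻¹ᵁ U' := by
      rw [hU.fromSpec_preimage_basicOpen]
      exact hg
    have h2 : hU.fromSpec p ∈ U' := h1
    rwa [hU.fromSpec_primeIdealOf] at h2
  let _ : Algebra Γ(Z.left, U) Γ(Z.left, U') := (resAlgHom Z hle).toAlgebra
  have : IsScalarTower ℂ Γ(Z.left, U) Γ(Z.left, U') :=
    IsScalarTower.of_algebraMap_eq' (resAlgHom Z hle).comp_algebraMap.symm
  have : IsLocalization.Away g Γ(Z.left, U') := hU.isLocalization_basicOpen g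
  have hchart : IsInChart b (e.hom.app _ (affinePoint Z hU')).toSubmodule := by
    rw [hom_app_affinePoint_of_le e hU hU' hle]
    exact H Γ(Z.left, U')
  obtain ⟨x, hx⟩ := exists_chartPoint_eq b hτ _ hchart
  refine ⟨U', hU', hz, σ, τ, inferInstance, inferInstance, MvPolynomial.aeval x, ?_, ?_, ?_⟩
  · rw [Nat.card_eq_fintype_card, hτ]
  · have := Fintype.ofFinite σ
    rw [Nat.card_eq_fintype_card, Nat.card_eq_fintype_card, finrank_eq_card_basis b,
      Fintype.card_sum]
  · have h1 := algSpec_map_chartMorphism e b hτ _ x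
    rw [hx] at h1
    rw [inv_app_hom_app] at h1
    have h2 : Spec.map (CommRingCat.ofHom (MvPolynomial.aeval x).toRingHom) ≫
        (chartMorphism e b hτ).left = hU'.fromSpec := congrArg CommaMorphism.left h1
    -- The chart composed with the coordinate map is the open immersion of `U'` in `Z`. As the chart
    -- is mono, the coordinate map is an open immersion; openness of the chart itself is not needed.
    refine MorphismProperty.of_postcomp (W := @IsOpenImmersion)
      (W' := MorphismProperty.monomorphisms Scheme) _ (chartMorphism e b hτ).left
      (mono_chartMorphism_left e b hτ) ?_
    rw [h2]
    infer_instance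

end SchemeChart

end GrassmannianFlop

namespace GrassmannianFlop

open Module

/-! ### Affine opens, and opens of affine space. -/

section AffineOpens

theorem topologicalKrullDim_eq_ringKrullDim_of_isAffineOpen {X : Scheme} {U : X.Opens}
    (hU : IsAffineOpen U) : topologicalKrullDim (U : Set X) = ringKrullDim Γ(X, U) := by
  rw [← PrimeSpectrum.topologicalKrullDim_eq_ringKrullDim]
  exact IsHomeomorph.topologicalKrullDim_eq _ hU.isoSpec.hom.homeomorph.isHomeomorph

theorem isOpenImmersion_Spec_map_resAlgHom (X : SchC) {U U' : X.left.Opens} (hU : IsAffineOpen U)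
    (hU' : IsAffineOpen U') (h : U' ≤ U) :
    IsOpenImmersion (Spec.map (CommRingCat.ofHom (resAlgHom X h).toRingHom)) := by
  have h1 : Spec.map (CommRingCat.ofHom (resAlgHom X h).toRingHom) ≫ hU.fromSpec = hU'.fromSpec :=
    hU.map_fromSpec hU' (homOfLE h).op
  have : IsOpenImmersion (Spec.map (CommRingCat.ofHom (resAlgHom X h).toRingHom) ≫ hU.fromSpec) := by
    rw [h1]
    infer_instance
  exact .of_comp _ hU.fromSpec

theorem etale_of_isOpenImmersion_Spec_map {A B : Type} [CommRing A] [CommRing B] (f : A →+* B)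
    [IsOpenImmersion (Spec.map (CommRingCat.ofHom f))] : f.Etale :=
  (HasRingHomProperty.Spec_iff (P := @Etale) (φ := CommRingCat.ofHom f)).1 inferInstance

theorem affineSpace_open_properties {σ C : Type} [Finite σ] [CommRing C] [Nontrivial C]
    [Algebra ℂ C] (f : MvPolynomial σ ℂ →ₐ[ℂ] C)
    [IsOpenImmersion (Spec.map (CommRingCat.ofHom f.toRingHom))] :
    IsDomain C ∧ Algebra.FiniteType ℂ C ∧ Algebra.FormallySmooth ℂ C ∧
      finrank C Ω[C⁄ℂ] = Nat.card σ := by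
  have hdom : IsDomain C := by
    have : Nonempty (Spec (CommRingCat.of C)) := inferInstanceAs (Nonempty (PrimeSpectrum C))
    have := isIntegral_of_isOpenImmersion (Spec.map (CommRingCat.ofHom f.toRingHom))
    exact (affine_isIntegral_iff (CommRingCat.of C)).1 this
  let _ : Algebra (MvPolynomial σ ℂ) C := f.toRingHom.toAlgebra
  have : IsScalarTower ℂ (MvPolynomial σ ℂ) C :=
    IsScalarTower.of_algebraMap_eq' f.comp_algebraMap.symm
  have het : Algebra.Etale (MvPolynomial σ ℂ) C := etale_of_isOpenImmersion_Spec_map f.toRingHom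
  have hflat : Module.Flat (MvPolynomial σ ℂ) C := inferInstance
  -- Étale implies flat, hence torsion-free over the polynomial ring.
  have hinj : Function.Injective (algebraMap (MvPolynomial σ ℂ) C) := by
    have := Module.Flat.isTorsionFree (R := MvPolynomial σ ℂ) (M := C)
    exact FaithfulSMul.algebraMap_injective _ _
  refine ⟨hdom, Algebra.FiniteType.trans (S := MvPolynomial σ ℂ) inferInstance inferInstance,
    Algebra.FormallySmooth.comp ℂ (MvPolynomial σ ℂ) C, ?_⟩
  rw [finrank_kaehlerDifferential_of_formallyEtale ℂ hinj,
    finrank_kaehlerDifferential_mvPolynomial]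

end AffineOpens

/-! ### Dimension of smooth integral schemes over `ℂ`. -/

section Smooth

variable {X : SchC}

theorem smooth_sections (hX : Smooth X.hom) {U : X.left.Opens} (hU : IsAffineOpen U) :
    Algebra.Smooth ℂ Γ(X.left, U) := by
  have h : Smooth (Spec.map (structureMap X U)) := by
    rw [← fromSpec_hom X hU]
    infer_instance
  exact (HasRingHomProperty.Spec_iff (P := @Smooth)).1 h

theorem finrank_kaehlerDifferential_eq_of_le [IsIntegral X.left] {U U' : X.left.Opens}
    (hU : IsAffineOpen U) (hU' : IsAffineOpen U') (h : U' ≤ U) (hne : (U' : Set X.left).Nonempty) :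
    finrank Γ(X.left, U') Ω[Γ(X.left, U')⁄ℂ] = finrank Γ(X.left, U) Ω[Γ(X.left, U)⁄ℂ] := by
  have : Nonempty U' := hne.to_subtype
  have := isOpenImmersion_Spec_map_resAlgHom X hU hU' h
  let _ : Algebra Γ(X.left, U) Γ(X.left, U') := (resAlgHom X h).toRingHom.toAlgebra
  have : IsScalarTower ℂ Γ(X.left, U) Γ(X.left, U') :=
    IsScalarTower.of_algebraMap_eq' (resAlgHom X h).comp_algebraMap.symm
  have het : Algebra.Etale Γ(X.left, U) Γ(X.left, U') :=
    etale_of_isOpenImmersion_Spec_map (resAlgHom X h).toRingHom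
  exact finrank_kaehlerDifferential_of_formallyEtale ℂ
    (map_injective_of_isIntegral X.left (homOfLE h))

theorem exists_isAffineOpen_le {X : Scheme} {O : X.Opens} {x : X} (hx : x ∈ O) :
    ∃ U : X.Opens, IsAffineOpen U ∧ x ∈ U ∧ U ≤ O := by
  obtain ⟨_, ⟨U, hU, rfl⟩, hxU, hle⟩ := X.isBasis_affineOpens.exists_subset_of_mem_open hx O.2
  exact ⟨U, hU, hxU, hle⟩

/-- Two nonempty opens of an integral scheme meet, so the ranks can be compared on a smaller affine
open. -/
theorem finrank_kaehlerDifferential_eq [IsIntegral X.left] {U U' : X.left.Opens}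
    (hU : IsAffineOpen U) (hU' : IsAffineOpen U') (hne : (U : Set X.left).Nonempty)
    (hne' : (U' : Set X.left).Nonempty) :
    finrank Γ(X.left, U') Ω[Γ(X.left, U')⁄ℂ] = finrank Γ(X.left, U) Ω[Γ(X.left, U)⁄ℂ] := by
  obtain ⟨x, hx⟩ := nonempty_preirreducible_inter U.2 U'.2 hne hne'
  obtain ⟨W, hW, hxW, hle⟩ := exists_isAffineOpen_le (O := U ⊓ U') hx
  rw [← finrank_kaehlerDifferential_eq_of_le hU hW (hle.trans inf_le_left) ⟨x, hxW⟩,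
    ← finrank_kaehlerDifferential_eq_of_le hU' hW (hle.trans inf_le_right) ⟨x, hxW⟩]

/-- The dimension of a smooth variety is the rank of its sheaf of differentials. -/
theorem topologicalKrullDim_eq_finrank_kaehlerDifferential [IsIntegral X.left]
    (hX : Smooth X.hom) {U : X.left.Opens} (hU : IsAffineOpen U)
    (hne : (U : Set X.left).Nonempty) :
    topologicalKrullDim X.left = finrank Γ(X.left, U) Ω[Γ(X.left, U)⁄ℂ] := by
  refine topologicalKrullDim_eq_of_forall_exists_isOpen fun x => ?_
  obtain ⟨U', hU', hxU', -⟩ := exists_isAffineOpen_le (O := ⊤) (x := x) trivial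
  have : Nonempty U' := ⟨⟨x, hxU'⟩⟩
  have := smooth_sections hX hU'
  refine ⟨U', U'.2, hxU', ?_⟩
  rw [topologicalKrullDim_eq_ringKrullDim_of_isAffineOpen hU',
    ringKrullDim_eq_finrank_kaehlerDifferential ℂ,
    finrank_kaehlerDifferential_eq hU hU' hne ⟨x, hxU'⟩]

end Smooth

/-! ### Dimensions of `Z` and `X`. -/

section Grassmannian

variable {Z : SchC} {V : Type} [AddCommGroup V] [Module ℂ V] [FiniteDimensional ℂ V] {r : ℕ}

/-- The origin of any chart is a `ℂ`-point. -/
theorem nonempty_of_grassmannianIso (e : GrassmannianIso Z V r) : Nonempty Z.left := by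
  let m := finrank ℂ V - r
  have hm : finrank ℂ V - m + m = finrank ℂ V := Nat.sub_add_cancel (Nat.sub_le _ _)
  let b : Basis (Fin (finrank ℂ V - m) ⊕ Fin m) ℂ V :=
    (finBasis ℂ V).reindex ((finCongr hm).symm.trans finSumFinEquiv.symm)
  let s := e.inv.app (CommAlgCat.of ℂ ℂ) (chartPoint b (Fintype.card_fin m) 0)
  have : Nonempty (Spec (CommRingCat.of ℂ)) := inferInstanceAs (Nonempty (PrimeSpectrum ℂ))
  exact this.map s.left

/-- A scheme isomorphic to the Grassmannian is locally an open subscheme of affine space. -/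
theorem exists_grassmannian_nhds (hr : r ≤ finrank ℂ V) (e : GrassmannianIso Z V r) (z : Z.left) :
    ∃ O : Z.left.Opens, z ∈ O ∧ ∀ U : Z.left.Opens, IsAffineOpen U → U ≤ O → z ∈ U →
      -- Allowing every small affine `U` matters: it will be the trace on `Z` of an affine open of
      -- `X`.
      IsDomain Γ(Z.left, U) ∧ Algebra.FiniteType ℂ Γ(Z.left, U) ∧
      Algebra.FormallySmooth ℂ Γ(Z.left, U) ∧
      finrank Γ(Z.left, U) Ω[Γ(Z.left, U)⁄ℂ] = r * (finrank ℂ V - r) := by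
  obtain ⟨O, hO, hz, σ, τ, _, _, f, hτ, hσ, hf⟩ := exists_isOpenImmersion_affineSpace e z
  refine ⟨O, hz, fun U hU hle hzU => ?_⟩
  have : Nonempty U := ⟨⟨z, hzU⟩⟩
  have := isOpenImmersion_Spec_map_resAlgHom Z hO hU hle
  have : IsOpenImmersion (Spec.map (CommRingCat.ofHom ((resAlgHom Z hle).comp f).toRingHom)) := by
    have h : CommRingCat.ofHom ((resAlgHom Z hle).comp f).toRingHom =
      CommRingCat.ofHom f.toRingHom ≫ CommRingCat.ofHom (resAlgHom Z hle).toRingHom := rfl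
    rw [h, Spec.map_comp]
    infer_instance
  have hcard : Nat.card (σ × τ) = r * (finrank ℂ V - r) := by
    rw [Nat.card_prod, hτ]
    congr 1
    omega
  rw [← hcard]
  exact affineSpace_open_properties ((resAlgHom Z hle).comp f)

theorem topologicalKrullDim_of_grassmannianIso (hr : r ≤ finrank ℂ V) (e : GrassmannianIso Z V r) :
    topologicalKrullDim Z.left = (r * (finrank ℂ V - r) : ℕ) := by
  have := nonempty_of_grassmannianIso e
  refine topologicalKrullDim_eq_of_forall_exists_isOpen fun z => ?_
  obtain ⟨O, hzO, hO⟩ := exists_grassmannian_nhds hr e z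
  obtain ⟨U, hU, hzU, hle⟩ := exists_isAffineOpen_le hzO
  obtain ⟨_, _, _, h⟩ := hO U hU hle hzU
  refine ⟨U, U.2, hzU, ?_⟩
  rw [topologicalKrullDim_eq_ringKrullDim_of_isAffineOpen hU,
    ringKrullDim_eq_finrank_kaehlerDifferential ℂ, h]

theorem topologicalKrullDim_of_normalBundleIso {X : SchC} [IsIntegral X.left]
    (hX : Smooth X.hom) (i : Z ⟶ X) [IsClosedImmersion i.left] (hr : r ≤ finrank ℂ V)
    (e : GrassmannianIso Z V r) {W : Type} [AddCommGroup W] [Module ℂ W] [FiniteDimensional ℂ W]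
    (ν : NormalBundleIso i e W) :
    topologicalKrullDim X.left = (r * finrank ℂ W + r * (finrank ℂ V - r) : ℕ) := by
  obtain ⟨z⟩ := nonempty_of_grassmannianIso e
  obtain ⟨O, hzO, hO⟩ := exists_grassmannian_nhds hr e z
  -- `Z` carries the subspace topology, so `O` is the trace of an open set of `X`.
  obtain ⟨O', hO', hOO'⟩ := i.left.isEmbedding.isInducing.isOpen_iff.1 O.2
  have hzO' : i.left z ∈ (⟨O', hO'⟩ : X.left.Opens) := by
    change z ∈ i.left ⁻¹' O'
    rw [hOO']
    exact hzO
  obtain ⟨U, hU, hzU, hle⟩ := exists_isAffineOpen_le hzO'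
  have hle' : i.left ⁻¹ᵁ U ≤ O := fun y hy => by
    have : y ∈ i.left ⁻¹' O' := hle hy
    rwa [hOO'] at this
  obtain ⟨_, _, _, hΩ⟩ := hO (i.left ⁻¹ᵁ U) (hU.preimage i.left) hle' hzU
  rw [topologicalKrullDim_eq_finrank_kaehlerDifferential hX hU ⟨_, hzU⟩]
  have : Nonempty U := ⟨⟨_, hzU⟩⟩
  have := smooth_sections hX hU
  have htower : IsScalarTower ℂ Γ(X.left, U) Γ(Z.left, i.left ⁻¹ᵁ U) := by
    refine IsScalarTower.of_algebraMap_eq' ?_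
    have h : structureMap X U ≫ i.left.app U = structureMap Z (i.left ⁻¹ᵁ U) := by
      have hw : X.hom.appTop ≫ i.left.appTop = Z.hom.appTop := by
        rw [← Scheme.Hom.comp_appTop, Over.w]
      simp only [structureMap, ← hw, Category.assoc]
      exact congrArg _ (congrArg _ (i.left.naturality (homOfLE le_top).op))
    exact congrArg CommRingCat.Hom.hom h.symm
  have hsurj : Function.Surjective (algebraMap Γ(X.left, U) Γ(Z.left, i.left ⁻¹ᵁ U)) :=
    i.left.app_surjective U hU
  rw [← finrank_normal_add_finrank_kaehlerDifferential ℂ hsurj, hΩ]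
  have h1 := (ν.equiv U hU).finrank_eq
  have h2 : finrank Γ(Z.left, i.left ⁻¹ᵁ U)
      (universalSub e (hU.preimage i.left) ⊗[ℂ] Module.Dual ℂ W) = r * finrank ℂ W := by
    refine (finrank_grassmannian_tensorProduct
      (e.hom.app _ (affinePoint Z (hU.preimage i.left)))).trans ?_
    rw [Subspace.dual_finrank_eq]
    congr 1
    omega
  have h3 := h1.symm.trans h2
  norm_cast
  congr 1

end Grassmannian

end GrassmannianFlop

theorem lemma2p1 (n r : ℕ) (hr : r < n)
    (V : Type) [AddCommGroup V] [Module ℂ V] [FiniteDimensional ℂ V]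
    (hV : Module.finrank ℂ V = n)
    (W : Type) [AddCommGroup W] [Module ℂ W] [FiniteDimensional ℂ W]
    (hW : Module.finrank ℂ W = n)
    (X : GrassmannianFlop.SchC) (hX : GrassmannianFlop.IsSmoothProjectiveVariety X)
    (Z : GrassmannianFlop.SchC) (i : Z ⟶ X) [IsClosedImmersion i.left]
    (e : GrassmannianFlop.GrassmannianIso Z V r)
    (ν : GrassmannianFlop.NormalBundleIso i e W) :
    topologicalKrullDim Z.left = ((r * (n - r) : ℕ) : WithBot ℕ∞) ∧
    topologicalKrullDim X.left = ((r * (n - r) + r * n : ℕ) : WithBot ℕ∞) ∧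
    ∀ (Y : GrassmannianFlop.SchC) (φ : X ⟶ Y) (p : Y.left),
      GrassmannianFlop.IsVariety Y →
      GrassmannianFlop.ContractsToPoint φ.left (Set.range i.left) p →
      GrassmannianFlop.IsSemismall φ.left := by
  have := hX.integral
  have hr' : r ≤ Module.finrank ℂ V := hV ▸ hr.le
  have hZdim := GrassmannianFlop.topologicalKrullDim_of_grassmannianIso hr' e
  have hXdim := GrassmannianFlop.topologicalKrullDim_of_normalBundleIso hX.smooth i hr' e ν
  rw [hV] at hZdim
  rw [hV, hW, add_comm] at hXdim
  refine ⟨hZdim, hXdim, fun Y φ p _ h => h.isSemismall ?_ ?_⟩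
  · have := GrassmannianFlop.nonempty_of_grassmannianIso e
    exact Set.range_nonempty _
  -- The contracted set is homeomorphic to `Z`; the inequality then amounts to n-r ≤ n.
  · have hrange : topologicalKrullDim (Set.range i.left) = topologicalKrullDim Z.left :=
      (IsHomeomorph.topologicalKrullDim_eq _
        i.left.isEmbedding.toHomeomorph.isHomeomorph).symm
    rw [hrange, hZdim, hXdim]
    have h1 : r * (n - r) ≤ r * n := Nat.mul_le_mul_left r (Nat.sub_le n r)
    have h2 : 2 * (r * (n - r)) ≤ r * (n - r) + r * n := by omega
    exact_mod_cast h2
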